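/- A \emph{topological graph} is a finite graph without loops or parallel edges, drawn in the plane so that its vertices are distinct points and its edges are non-self-intersecting arcs connecting the corresponding points; an arc passes through no vertex other than its endpoints, and two edges that share an interior point properly cross at that point. Two edges may meet any number of times. Two edges \emph{cross} if their interiors share a point. A topological graph is \emph{$k$-quasi-planar} if it does not contain $k$ pairwise crossing edges. A curve is \emph{$x$-monotone} if every vertical line meets it in at most one point. \textbf{Theorem.} There is an absolute constant $c > 0$ such that, for all $n$ and $k$, every $n$-vertex $k$-quasi-planar topological graph $G = (V,E)$ all of whose edges are drawn as $x$-monotone curves satisfies $|E(G)| \le 2^{ck^3}\, n \log n$. -/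

import Mathlib

/-- The relative interior of a parametrized arc in the plane: the arc without its endpoints. -/
def arcInterior (γ : C(unitInterval, ℝ × ℝ)) : Set (ℝ × ℝ) :=
  γ '' Set.Ioo 0 1

/-- The curves `A` and `B` properly cross at `p`: near `p`, some homeomorphism between open subsets
of the plane takes `p` to the origin, `A` to the vertical axis and `B` to the horizontal axis. -/
def ProperlyCrossAt (A B : Set (ℝ × ℝ)) (p : ℝ × ℝ) : Prop :=
  ∃ φ : OpenPartialHomeomorph (ℝ × ℝ) (ℝ × ℝ), p ∈ φ.source ∧ φ p = 0 ∧
    ∀ q ∈ φ.source, (q ∈ A ↔ (φ q).1 = 0) ∧ (q ∈ B ↔ (φ q).2 = 0)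

/-- A topological graph on the vertex set `V`: a graph without loops or parallel edges, drawn in
the plane with its vertices as distinct points and its edges as non-self-intersecting arcs. -/
structure TopologicalGraph (V : Type*) where
  /-- The underlying abstract graph. -/
  graph : SimpleGraph V
  /-- The point that represents a vertex. -/
  point : V → ℝ × ℝ
  /-- A parametrization of the arc that represents an edge. -/
  curve : graph.edgeSet → C(unitInterval, ℝ × ℝ)
  point_injective : Function.Injective point
  /-- The arcs do not intersect themselves. -/
  curve_injective : ∀ e, Function.Injective (curve e)
  /-- The arc of an edge joins the points that represent the two ends of the edge. -/
  curve_ends : ∀ e, s(curve e 0, curve e 1) = Sym2.map point e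
  /-- Arcs do not pass through vertices, except for their endpoints. -/
  point_notMem : ∀ e v, point v ∉ arcInterior (curve e)
  /-- There are no tangencies: two edges properly cross at every common interior point. -/
  properlyCrossAt : ∀ e f, e ≠ f → ∀ p ∈ arcInterior (curve e) ∩ arcInterior (curve f),
    ProperlyCrossAt (arcInterior (curve e)) (arcInterior (curve f)) p

namespace TopologicalGraph

variable {V : Type*} (D : TopologicalGraph V)

/-- Two edges cross if their interiors share a point. -/
def Cross (e f : D.graph.edgeSet) : Prop :=
  (arcInterior (D.curve e) ∩ arcInterior (D.curve f)).Nonempty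

/-- A topological graph is `k`-quasi-planar if it has no `k` pairwise crossing edges. -/
def IsQuasiPlanar (k : ℕ) : Prop :=
  ¬ ∃ S : Finset D.graph.edgeSet, S.card = k ∧ (S : Set D.graph.edgeSet).Pairwise D.Cross

/-- All edges are drawn as `x`-monotone curves: every vertical line meets the arc of an edge in
at most one point. -/
def IsXMonotone : Prop :=
  ∀ e, ∀ p ∈ Set.range (D.curve e), ∀ q ∈ Set.range (D.curve e), p.1 = q.1 → p = q

end TopologicalGraph

/-!
The vertices are split at a vertical line through a median; iterating this, the logarithm comes from
the depth of the recursion, and it remains to see that only linearly many edges cross a given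
vertical line `L`, with a constant `2 ^ O(w ^ 3)` where `w = k - 1` (`HeightFunctions.card_edges_le`,
`GroundedFamily.card_le_of_crossing_line`).

Cut the edges at `L` into left and right halves. Halves with a common starting vertex that do not
meet are vertically ordered, so by Dilworth's theorem a fraction `1 / w ^ 2` of the edges can be kept
such that, on either side of `L`, edges with a common vertex do not meet. Order these edges by their
heights on `L` and divide them into blocks of `r ^ 2` consecutive edges. Edges are determined by
their ends, so a block has at least `r` distinct left ends or at least `r` distinct right ends. It
therefore suffices that on each side the number of incidences of vertices and blocks is linear in the
number of vertices plus the number of blocks: a large `r` then bounds the number of blocks.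

For this, rank the vertices by the last edge they occur in, and consider the 0-1 matrix of incidences
of vertices (rows) and blocks (columns). If it has a nest, that is, rows `a₁ < ⋯ < a_l` with entries in
columns in the order `a₁, …, a_l, a_l, …, a₁`, then the last occurrences complete it to the order
`a₁ … a_l a_l … a₁ a₁ … a_l` on `L`. Such a zigzag with `l > w ^ 3` yields more than `w` pairwise
crossing edges (`GroundedFamily.zigzag_length_le`): when two curves of the middle run do not meet, the
starting vertex further to the right forces two curves of the first or of the last run to meet, which
gives two partial orders on the `l` vertices without chains longer than `w`.

A matrix without nests of length `l` has at most `6 ^ l` times as many entries as rows and columns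
(`card_le_of_not_isNest`), by induction on `l`: a maximal submatrix in which any two entries of a row
enclose two entries of a higher row has no nest of length `l - 1`, and the other entries are counted
by a charging argument (`card_interior_le`).
-/

/-! ### Nested repetitions in 0-1 matrices -/

/-- A finite set of pairs is read as a 0-1 matrix (row, column). `HasDouble M x u w` says that
strictly between the columns `u` and `w` some row above index `x` has two entries. -/
def HasDouble (M : Finset (ℕ × ℕ)) (x u w : ℕ) : Prop :=
  ∃ y c d, x < y ∧ u < c ∧ c < d ∧ d < w ∧ (y, c) ∈ M ∧ (y, d) ∈ M

/-- Rows `a 0 < ⋯ < a (l - 1)` of the matrix `M`, with two entries each, in columns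
`c 0 < ⋯ < c (l - 1) < d (l - 1) < ⋯ < d 0`. -/
structure IsNest (M : Finset (ℕ × ℕ)) (l : ℕ) (a c d : ℕ → ℕ) : Prop where
  mem_left : ∀ i < l, (a i, c i) ∈ M
  mem_right : ∀ i < l, (a i, d i) ∈ M
  lt : ∀ i < l, c i < d i
  row_lt : ∀ i j, i < j → j < l → a i < a j
  left_lt : ∀ i j, i < j → j < l → c i < c j
  right_lt : ∀ i j, i < j → j < l → d j < d i

open Classical in
/-- If `H` is a family of row intervals without double entries of higher rows, then the number of
entries in the interior of an interval of their own row is at most the number of columns plus the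
number of intervals: such an entry is the lowest of its column, or it is charged to the interval of
the highest row below it whose interior contains its column. -/
theorem card_interior_le (M : Finset (ℕ × ℕ)) (H : Finset (ℕ × ℕ × ℕ))
    (hH : ∀ h ∈ H, (h.1, h.2.1) ∈ M ∧ (h.1, h.2.2) ∈ M ∧ ¬ HasDouble M h.1 h.2.1 h.2.2) :
    (M.filter fun o => ∃ h ∈ H, h.1 = o.1 ∧ h.2.1 < o.2 ∧ o.2 < h.2.2).card ≤
      (M.image Prod.snd).card + H.card := by
  set I := M.filter fun o => ∃ h ∈ H, h.1 = o.1 ∧ h.2.1 < o.2 ∧ o.2 < h.2.2 with hI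
  have hIM : ∀ o ∈ I, o ∈ M := fun o ho => (Finset.mem_filter.1 ho).1
  rw [← Finset.card_filter_add_card_filter_not (s := I) (fun o => ∀ y < o.1, (y, o.2) ∉ I)]
  refine Nat.add_le_add ?_ ?_
  · refine Finset.card_le_card_of_injOn Prod.snd ?_ ?_
    · intro o ho
      exact Finset.mem_coe.2 (Finset.mem_image_of_mem _ (hIM o (Finset.mem_filter.1 ho).1))
    · rintro ⟨x, c⟩ ho ⟨y, d⟩ ho' (rfl : c = d)
      have h1 := Finset.mem_filter.1 (Finset.mem_coe.1 ho)
      have h2 := Finset.mem_filter.1 (Finset.mem_coe.1 ho')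
      rcases lt_trichotomy x y with h | h | h
      · exact absurd h1.1 (h2.2 x h)
      · rw [h]
      · exact absurd h2.1 (h1.2 y h)
  · have key : ∀ o ∈ I.filter (fun o => ¬ ∀ y < o.1, (y, o.2) ∉ I),
        ∃ h ∈ H, (h.1 < o.1 ∧ h.2.1 < o.2 ∧ o.2 < h.2.2) ∧
          ∀ h' ∈ H, h'.1 < o.1 → h'.2.1 < o.2 → o.2 < h'.2.2 → h'.1 ≤ h.1 := by
      intro o ho
      obtain ⟨hoI, hne⟩ := Finset.mem_filter.1 ho
      push Not at hne
      obtain ⟨y, hy, hyI⟩ := hne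
      obtain ⟨-, h, hh, h1, h2, h3⟩ := Finset.mem_filter.1 hyI
      obtain ⟨m, hm, hmax⟩ := Finset.exists_max_image
        (H.filter fun h => h.1 < o.1 ∧ h.2.1 < o.2 ∧ o.2 < h.2.2) (fun h => h.1)
        ⟨h, Finset.mem_filter.2 ⟨hh, by simp only at h1; omega, h2, h3⟩⟩
      obtain ⟨hmH, hm'⟩ := Finset.mem_filter.1 hm
      exact ⟨m, hmH, hm', fun h' hh' a b c =>
        hmax h' (Finset.mem_filter.2 ⟨hh', a, b, c⟩)⟩
    choose! f hfH hf hfmax using key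
    -- two entries charged to the same interval cannot lie in different rows
    have no_lt : ∀ o ∈ I.filter (fun o => ¬ ∀ y < o.1, (y, o.2) ∉ I),
        ∀ o' ∈ I.filter (fun o => ¬ ∀ y < o.1, (y, o.2) ∉ I), f o = f o' → ¬ o.1 < o'.1 := by
      intro o ho o' ho' he hlt
      obtain ⟨hoM, h, hh, h1, h2, h3⟩ := Finset.mem_filter.1 (Finset.mem_filter.1 ho).1
      obtain ⟨f1, f2, f3⟩ := hf o ho
      obtain ⟨g1, g2, g3⟩ := hf o' ho'
      obtain ⟨hu, hw, -⟩ := hH h hh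
      have hnd := (hH _ (hfH o ho)).2.2
      rw [h1] at hu hw
      have hu' : h.2.1 ≤ (f o).2.1 := by
        by_contra hc
        exact hnd ⟨o.1, h.2.1, o.2, f1, by omega, h2, f3, hu, hoM⟩
      have hw' : (f o).2.2 ≤ h.2.2 := by
        by_contra hc
        exact hnd ⟨o.1, o.2, h.2.2, f1, f2, h3, by omega, hoM, hw⟩
      rw [← he] at g2 g3
      have := hfmax o' ho' h hh (by omega) (by omega) (by omega)
      rw [← he] at this
      omega
    refine Finset.card_le_card_of_injOn f (fun o ho => hfH o ho) ?_
    intro o ho o' ho' he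
    have e1 : o.1 = o'.1 :=
      le_antisymm (not_lt.1 (no_lt o' ho' o ho he.symm)) (not_lt.1 (no_lt o ho o' ho' he))
    have hoM := hIM o (Finset.mem_filter.1 ho).1
    have hoM' := hIM o' (Finset.mem_filter.1 ho').1
    obtain ⟨f1, f2, f3⟩ := hf o ho
    obtain ⟨g1, g2, g3⟩ := hf o' ho'
    rw [← he] at g2 g3
    have hnd := (hH _ (hfH o ho)).2.2
    refine Prod.ext e1 ?_
    rcases lt_trichotomy o.2 o'.2 with h | h | h
    · exact absurd ⟨o.1, o.2, o'.2, f1, f2, h, g3, hoM, by rw [e1]; exact hoM'⟩ hnd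
    · exact h
    · exact absurd ⟨o.1, o'.2, o.2, f1, g2, h, f3, by rw [e1]; exact hoM', hoM⟩ hnd

open Classical in
/-- A matrix has a submatrix with, up to the number of columns, at least a fifth of its entries, such
that any two entries in a row of the submatrix enclose a double entry of a higher row. -/
theorem exists_spread_subset (M : Finset (ℕ × ℕ)) :
    ∃ M' ⊆ M, M.card ≤ 5 * M'.card + (M.image Prod.snd).card ∧
      ∀ x u w, (x, u) ∈ M' → (x, w) ∈ M' → u < w → HasDouble M x u w := by
  set P : Finset (ℕ × ℕ) → Prop := fun N =>
    ∀ x u w, (x, u) ∈ N → (x, w) ∈ N → u < w → HasDouble M x u w with hP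
  obtain ⟨N, hN, hmax⟩ := Finset.exists_max_image (M.powerset.filter P) Finset.card
    ⟨∅, Finset.mem_filter.2 ⟨Finset.mem_powerset.2 (Finset.empty_subset _), by simp [hP]⟩⟩
  obtain ⟨hNM, hNP⟩ := Finset.mem_filter.1 hN
  rw [Finset.mem_powerset] at hNM
  refine ⟨N, hNM, ?_, hNP⟩
  -- the farthest entries to the right and to the left before a double entry is enclosed
  have hr : ∀ p ∈ N, ∃ w, ((p.1, w) ∈ M ∧ ¬ HasDouble M p.1 p.2 w) ∧
      ∀ w', (p.1, w') ∈ M → ¬ HasDouble M p.1 p.2 w' → w' ≤ w := by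
    intro p hp
    obtain ⟨m, hm, hmm⟩ := Finset.exists_max_image
      (M.filter fun o => o.1 = p.1 ∧ ¬ HasDouble M p.1 p.2 o.2) Prod.snd
      ⟨p, Finset.mem_filter.2 ⟨hNM hp, rfl, by rintro ⟨y, c, d, h⟩; omega⟩⟩
    obtain ⟨h1, h2, h3⟩ := Finset.mem_filter.1 hm
    refine ⟨m.2, ⟨h2 ▸ h1, h3⟩, fun w' h h' => hmm (p.1, w') ?_⟩
    exact Finset.mem_filter.2 ⟨h, rfl, h'⟩
  have hl : ∀ p ∈ N, ∃ u, ((p.1, u) ∈ M ∧ ¬ HasDouble M p.1 u p.2) ∧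
      ∀ u', (p.1, u') ∈ M → ¬ HasDouble M p.1 u' p.2 → u ≤ u' := by
    intro p hp
    obtain ⟨m, hm, hmm⟩ := Finset.exists_min_image
      (M.filter fun o => o.1 = p.1 ∧ ¬ HasDouble M p.1 o.2 p.2) Prod.snd
      ⟨p, Finset.mem_filter.2 ⟨hNM hp, rfl, by rintro ⟨y, c, d, h⟩; omega⟩⟩
    obtain ⟨h1, h2, h3⟩ := Finset.mem_filter.1 hm
    refine ⟨m.2, ⟨h2 ▸ h1, h3⟩, fun w' h h' => hmm (p.1, w') ?_⟩
    exact Finset.mem_filter.2 ⟨h, rfl, h'⟩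
  choose! e he hemax using hr
  choose! b hb hbmin using hl
  set H : Finset (ℕ × ℕ × ℕ) :=
    (N.image fun p => (p.1, p.2, e p)) ∪ N.image fun p => (p.1, b p, p.2) with hH
  have hHcard : H.card ≤ 2 * N.card := by
    refine (Finset.card_union_le _ _).trans ?_
    have h1 := Finset.card_image_le (s := N) (f := fun p => (p.1, p.2, e p))
    have h2 := Finset.card_image_le (s := N) (f := fun p => (p.1, b p, p.2))
    omega
  have hint := card_interior_le M H (by
    intro h hh
    rcases Finset.mem_union.1 hh with hh | hh
    · obtain ⟨p, hp, rfl⟩ := Finset.mem_image.1 hh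
      exact ⟨hNM hp, (he p hp).1, (he p hp).2⟩
    · obtain ⟨p, hp, rfl⟩ := Finset.mem_image.1 hh
      exact ⟨(hb p hp).1, hNM hp, (hb p hp).2⟩)
  have hcover : M ⊆ ((N ∪ N.image fun p => (p.1, e p)) ∪ N.image fun p => (p.1, b p)) ∪
      M.filter fun o => ∃ h ∈ H, h.1 = o.1 ∧ h.2.1 < o.2 ∧ o.2 < h.2.2 := by
    intro o ho
    by_cases hoN : o ∈ N
    · simp [hoN]
    have hbad : ¬ P (insert o N) := by
      intro hPo
      have := hmax (insert o N) (Finset.mem_filter.2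
        ⟨Finset.mem_powerset.2 (Finset.insert_subset ho hNM), hPo⟩)
      rw [Finset.card_insert_of_notMem hoN] at this
      omega
    simp only [hP] at hbad
    push Not at hbad
    obtain ⟨x, u, w, hu, hw, huw, hnd⟩ := hbad
    rw [Finset.mem_insert] at hu hw
    rcases hu with hu | hu
    · rcases hw with hw | hw
      · have := hu.trans hw.symm
        simp at this
        omega
      · -- `o` lies to the left of the entry `(x, w)` of `N`
        subst hu
        have hle := hbmin _ hw u ho hnd
        rcases hle.eq_or_lt with h | h
        · refine Finset.mem_union_left _ (Finset.mem_union_right _ ?_)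
          exact Finset.mem_image.2 ⟨_, hw, by simp [h]⟩
        · refine Finset.mem_union_right _
            (Finset.mem_filter.2 ⟨ho, (x, b (x, w), w), ?_, rfl, h, huw⟩)
          exact Finset.mem_union_right _ (Finset.mem_image.2 ⟨_, hw, rfl⟩)
    · rcases hw with hw | hw
      · subst hw
        have hle := hemax _ hu w ho hnd
        rcases hle.eq_or_lt with h | h
        · refine Finset.mem_union_left _ (Finset.mem_union_left _ (Finset.mem_union_right _ ?_))
          exact Finset.mem_image.2 ⟨_, hu, by simp [h]⟩
        · refine Finset.mem_union_right _
            (Finset.mem_filter.2 ⟨ho, (x, u, e (x, u)), ?_, rfl, huw, h⟩)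
          exact Finset.mem_union_left _ (Finset.mem_image.2 ⟨_, hu, rfl⟩)
      · exact absurd (hNP x u w hu hw huw) hnd
  have h0 := Finset.card_le_card hcover
  have h1 := Finset.card_union_le ((N ∪ N.image fun p => (p.1, e p)) ∪ N.image fun p => (p.1, b p))
    (M.filter fun o => ∃ h ∈ H, h.1 = o.1 ∧ h.2.1 < o.2 ∧ o.2 < h.2.2)
  have h2 := Finset.card_union_le (N ∪ N.image fun p => (p.1, e p)) (N.image fun p => (p.1, b p))
  have h3 := Finset.card_union_le N (N.image fun p => (p.1, e p))
  have h4 := Finset.card_image_le (s := N) (f := fun p => (p.1, e p))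
  have h5 := Finset.card_image_le (s := N) (f := fun p => (p.1, b p))
  omega

/-- A nest in a submatrix as in `exists_spread_subset` extends inwards. -/
theorem IsNest.extend {M M' : Finset (ℕ × ℕ)} (hM : M' ⊆ M)
    (hs : ∀ x u w, (x, u) ∈ M' → (x, w) ∈ M' → u < w → HasDouble M x u w)
    {l : ℕ} {a c d : ℕ → ℕ} (h : IsNest M' (l + 1) a c d) :
    ∃ a c d, IsNest M (l + 2) a c d := by
  obtain ⟨y, u, w, hy, hu, huw, hw, huM, hwM⟩ :=
    hs _ _ _ (h.mem_left l (by omega)) (h.mem_right l (by omega)) (h.lt l (by omega))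
  have row : ∀ i < l + 1, a i < y := fun i hi => by
    rcases Nat.lt_succ_iff_lt_or_eq.1 hi with hi | rfl
    · exact (h.row_lt i l hi (by omega)).trans hy
    · exact hy
  have left : ∀ i < l + 1, c i < u := fun i hi => by
    rcases Nat.lt_succ_iff_lt_or_eq.1 hi with hi | rfl
    · exact (h.left_lt i l hi (by omega)).trans hu
    · exact hu
  have right : ∀ i < l + 1, w < d i := fun i hi => by
    rcases Nat.lt_succ_iff_lt_or_eq.1 hi with hi | rfl
    · exact hw.trans (h.right_lt i l hi (by omega))
    · exact hw
  refine ⟨fun i => if i < l + 1 then a i else y, fun i => if i < l + 1 then c i else u,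
    fun i => if i < l + 1 then d i else w, ?_, ?_, ?_, ?_, ?_, ?_⟩
  · intro i hi
    by_cases h1 : i < l + 1
    · simpa [h1] using hM (h.mem_left i h1)
    · simpa [h1] using huM
  · intro i hi
    by_cases h1 : i < l + 1
    · simpa [h1] using hM (h.mem_right i h1)
    · simpa [h1] using hwM
  · intro i hi
    by_cases h1 : i < l + 1
    · simpa [h1] using h.lt i h1
    · simpa [h1] using huw
  all_goals
    intro i j hij hj
    have hi : i < l + 1 := by omega
    by_cases h1 : j < l + 1
  · simpa [hi, h1] using h.row_lt i j hij h1
  · simpa [hi, h1] using row i hi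
  · simpa [hi, h1] using h.left_lt i j hij h1
  · simpa [hi, h1] using left i hi
  · simpa [hi, h1] using h.right_lt i j hij h1
  · simpa [hi, h1] using right i hi

/-- A matrix without nests of length `l + 1` has at most linearly many entries. -/
theorem card_le_of_not_isNest (l : ℕ) (M : Finset (ℕ × ℕ))
    (hM : ∀ a c d, ¬ IsNest M (l + 1) a c d) :
    M.card ≤ 6 ^ (l + 1) * ((M.image Prod.fst).card + (M.image Prod.snd).card) := by
  induction l generalizing M with
  | zero =>
    have : M.card ≤ (M.image Prod.fst).card := by
      refine Finset.card_le_card_of_injOn Prod.fst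
        (fun o ho => Finset.mem_coe.2 (Finset.mem_image_of_mem _ ho)) ?_
      have no : ∀ x u w, (x, u) ∈ M → (x, w) ∈ M → ¬ u < w := by
        intro x u w hu hw huw
        refine hM (fun _ => x) (fun _ => u) (fun _ => w) ⟨fun _ _ => hu, fun _ _ => hw,
          fun _ _ => huw, ?_, ?_, ?_⟩ <;> intro i j hij hj <;> omega
      rintro ⟨x, u⟩ hu ⟨y, w⟩ hw (rfl : x = y)
      have h1 := no x u w hu hw
      have h2 := no x w u hw hu
      exact Prod.ext rfl (by simp only; omega)
    omega
  | succ l ih =>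
    obtain ⟨M', hsub, hcard, hs⟩ := exists_spread_subset M
    have h := ih M' (fun a c d hn => by
      obtain ⟨a, c, d, h⟩ := hn.extend hsub hs
      exact hM a c d h)
    have h1 := Finset.card_le_card (Finset.image_subset_image (f := Prod.fst) hsub)
    have h2 := Finset.card_le_card (Finset.image_subset_image (f := Prod.snd) hsub)
    have h3 : M'.card ≤ 6 ^ (l + 1) * ((M.image Prod.fst).card + (M.image Prod.snd).card) :=
      h.trans (Nat.mul_le_mul_left _ (by omega))
    have h4 : (M.image Prod.snd).card ≤
        6 ^ (l + 1) * ((M.image Prod.fst).card + (M.image Prod.snd).card) :=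
      (Nat.le_add_left _ _).trans (Nat.le_mul_of_pos_left _ (by positivity))
    have h5 : 6 ^ (l + 1 + 1) * ((M.image Prod.fst).card + (M.image Prod.snd).card) =
        6 * (6 ^ (l + 1) * ((M.image Prod.fst).card + (M.image Prod.snd).card)) := by ring
    omega

/-! ### Chains and antichains -/

open Classical in
/-- **Dilworth's theorem** for a finite strict order: a set whose antichains have at most `w`
elements is covered by `w` chains. The chains are the colour classes of `f`. -/
theorem exists_chain_coloring {α : Type*} [Finite α] (r : α → α → Prop) [IsStrictOrder α r]
    (s : Finset α) (w : ℕ)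
    (hw : ∀ A ⊆ s, (∀ x ∈ A, ∀ y ∈ A, ¬ r x y) → A.card ≤ w) :
    ∃ f : α → ℕ, (∀ x ∈ s, f x < w) ∧
      ∀ x ∈ s, ∀ y ∈ s, f x = f y → x = y ∨ r x y ∨ r y x := by
  have wf : WellFounded (Function.swap r) :=
    @Finite.wellFounded_of_trans_of_irrefl α _ (Function.swap r)
      ⟨fun a b c h1 h2 => _root_.trans (r := r) h2 h1⟩ ⟨fun a => irrefl_of r a⟩
  induction hn : s.card using Nat.strong_induction_on generalizing s w with
  | _ n ih =>
  subst hn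
  rcases s.eq_empty_or_nonempty with rfl | hne
  · exact ⟨fun _ => 0, by simp, by simp⟩
  obtain ⟨a, has, hamax⟩ := wf.has_min (s : Set α) hne
  have hamax' : ∀ x ∈ s, ¬ r a x := fun x hx => hamax x hx
  set t := s.erase a with ht
  have hts : t ⊆ s := Finset.erase_subset _ _
  have htc : t.card < s.card := Finset.card_erase_lt_of_mem has
  have hw1 : 1 ≤ w := by
    have := hw {a} (by simpa using has) (by
      simp only [Finset.mem_singleton]
      rintro x rfl y rfl
      exact irrefl_of r _)
    simpa using this
  by_cases hA : ∀ A ⊆ t, (∀ x ∈ A, ∀ y ∈ A, ¬ r x y) → A.card ≤ w - 1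
  · -- `a` gets a colour of its own
    obtain ⟨f, hf, hfc⟩ := ih t.card htc t (w - 1) hA rfl
    refine ⟨fun x => if x = a then w - 1 else f x, ?_, ?_⟩
    · intro x hx
      by_cases hxa : x = a
      · simp [hxa]; omega
      · have := hf x (Finset.mem_erase.2 ⟨hxa, hx⟩)
        simp only [hxa, if_false]; omega
    · intro x hx y hy hxy
      by_cases hxa : x = a <;> by_cases hya : y = a
      · exact Or.inl (hxa.trans hya.symm)
      · have := hf y (Finset.mem_erase.2 ⟨hya, hy⟩)
        simp only [hxa, hya, if_true, if_false] at hxy; omega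
      · have := hf x (Finset.mem_erase.2 ⟨hxa, hx⟩)
        simp only [hxa, hya, if_true, if_false] at hxy; omega
      · simp only [hxa, hya, if_false] at hxy
        exact hfc x (Finset.mem_erase.2 ⟨hxa, hx⟩) y (Finset.mem_erase.2 ⟨hya, hy⟩) hxy
  push Not at hA
  obtain ⟨A₀, hA₀t, hA₀, hA₀c⟩ := hA
  obtain ⟨f, hf, hfc⟩ := ih t.card htc t w (fun A hAt => hw A (hAt.trans hts)) rfl
  -- an antichain of size `w` meets every chain
  have meets : ∀ A ⊆ t, (∀ x ∈ A, ∀ y ∈ A, ¬ r x y) → A.card = w → ∀ i < w, ∃ x ∈ A, f x = i := by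
    intro A hAt hAa hAc i hi
    have hinj : Set.InjOn f A := fun x hx y hy hxy => by
      rcases hfc x (hAt hx) y (hAt hy) hxy with h | h | h
      · exact h
      · exact absurd h (hAa x hx y hy)
      · exact absurd h (hAa y hy x hx)
    have hsub : A.image f ⊆ Finset.range w := by
      intro j hj
      obtain ⟨x, hx, rfl⟩ := Finset.mem_image.1 hj
      exact Finset.mem_range.2 (hf x (hAt hx))
    have heq := Finset.eq_of_subset_of_card_le hsub (by
      rw [Finset.card_image_of_injOn hinj, hAc, Finset.card_range])
    have : i ∈ A.image f := by rw [heq]; exact Finset.mem_range.2 hi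
    exact Finset.mem_image.1 this
  have hA₀w : A₀.card = w := le_antisymm (hw A₀ (hA₀t.trans hts) hA₀) (by omega)
  -- the highest element of each chain that lies in an antichain of size `w`
  have top : ∀ i < w, ∃ x, (f x = i ∧ ∃ A ⊆ t, (∀ x ∈ A, ∀ y ∈ A, ¬ r x y) ∧ A.card = w ∧ x ∈ A) ∧
      ∀ y, f y = i → (∃ A ⊆ t, (∀ x ∈ A, ∀ y ∈ A, ¬ r x y) ∧ A.card = w ∧ y ∈ A) →
        y = x ∨ r y x := by
    intro i hi
    obtain ⟨x₀, hx₀, hx₀i⟩ := meets A₀ hA₀t hA₀ hA₀w i hi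
    obtain ⟨x, ⟨hxi, A, hAt, hAa, hAc, hxA⟩, hxm⟩ := wf.has_min
      {x | f x = i ∧ ∃ A ⊆ t, (∀ x ∈ A, ∀ y ∈ A, ¬ r x y) ∧ A.card = w ∧ x ∈ A}
      ⟨x₀, hx₀i, A₀, hA₀t, hA₀, hA₀w, hx₀⟩
    refine ⟨x, ⟨hxi, A, hAt, hAa, hAc, hxA⟩, ?_⟩
    intro y hyi hy
    have hnr : ¬ r x y := hxm y ⟨hyi, hy⟩
    obtain ⟨B, hBt, -, -, hyB⟩ := hy
    rcases hfc y (hBt hyB) x (hAt hxA) (hyi.trans hxi.symm) with h | h | h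
    · exact Or.inl h
    · exact Or.inr h
    · exact absurd h hnr
  have : Nonempty α := ⟨a⟩
  choose! x hx hxmax using top
  have hxt : ∀ i < w, x i ∈ t := fun i hi => by
    obtain ⟨-, A, hAt, -, -, hm⟩ := hx i hi
    exact hAt hm
  have hxanti : ∀ i < w, ∀ j < w, ¬ r (x i) (x j) := by
    intro i hi j hj hij
    obtain ⟨-, A, hAt, hAa, hAc, hxA⟩ := hx j hj
    obtain ⟨y, hyA, hyi⟩ := meets A hAt hAa hAc i hi
    rcases hxmax i hi y hyi ⟨A, hAt, hAa, hAc, hyA⟩ with h | h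
    · exact hAa _ hyA _ hxA (h ▸ hij)
    · exact hAa _ hyA _ hxA (_root_.trans (r := r) h hij)
  have hxinj : Set.InjOn x (Finset.range w : Set ℕ) := fun i hi j hj hij => by
    have hi' := Finset.mem_range.1 (Finset.mem_coe.1 hi)
    have hj' := Finset.mem_range.1 (Finset.mem_coe.1 hj)
    rw [← (hx i hi').1, ← (hx j hj').1, hij]
  obtain ⟨i, hi, hia⟩ : ∃ i < w, r (x i) a := by
    by_contra hcon
    push Not at hcon
    have hmem : ∀ y ∈ (Finset.range w).image x, ∃ i < w, x i = y := fun y hy => by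
      obtain ⟨i, hi, rfl⟩ := Finset.mem_image.1 hy
      exact ⟨i, Finset.mem_range.1 hi, rfl⟩
    have hacard : ((insert a ((Finset.range w).image x)) : Finset α).card ≤ w := by
      refine hw _ ?_ ?_
      · intro y hy
        rcases Finset.mem_insert.1 hy with rfl | hy
        · exact has
        · obtain ⟨i, hi, rfl⟩ := hmem y hy
          exact hts (hxt i hi)
      · intro y hy z hz hyz
        rcases Finset.mem_insert.1 hy with rfl | hy
        · rcases Finset.mem_insert.1 hz with rfl | hz
          · exact irrefl_of r _ hyz
          · obtain ⟨i, hi, rfl⟩ := hmem z hz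
            exact hamax' _ (hts (hxt i hi)) hyz
        · obtain ⟨i, hi, rfl⟩ := hmem y hy
          rcases Finset.mem_insert.1 hz with rfl | hz
          · exact hcon i hi hyz
          · obtain ⟨j, hj, rfl⟩ := hmem z hz
            exact hxanti i hi j hj hyz
    rw [Finset.card_insert_of_notMem, Finset.card_image_of_injOn hxinj, Finset.card_range] at hacard
    · omega
    · intro h
      obtain ⟨i, hi, hia⟩ := hmem a h
      have hmem_t := hxt i hi
      rw [hia] at hmem_t
      exact Finset.notMem_erase a s hmem_t
  -- remove `a` together with the part of the chain of `x i` up to `x i`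
  set K : Finset α := insert a (t.filter fun z => f z = i ∧ (z = x i ∨ r z (x i))) with hK
  have hKs : s \ K ⊆ t := fun z hz => by
    obtain ⟨hz, hzK⟩ := Finset.mem_sdiff.1 hz
    exact Finset.mem_erase.2 ⟨fun h => hzK (h ▸ Finset.mem_insert_self _ _), hz⟩
  obtain ⟨g, hg, hgc⟩ := ih (s \ K).card
    (Finset.card_lt_card (Finset.ssubset_iff_subset_ne.2 ⟨Finset.sdiff_subset, fun h => by
      have := h.symm ▸ has
      exact (Finset.mem_sdiff.1 this).2 (Finset.mem_insert_self _ _)⟩)) (s \ K) (w - 1) (by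
    intro A hAs hAa
    have h1 := hw A (hAs.trans Finset.sdiff_subset) hAa
    by_contra hcon
    have hAw : A.card = w := by omega
    have hAt := hAs.trans hKs
    obtain ⟨y, hyA, hyi⟩ := meets A hAt hAa hAw i hi
    have := hxmax i hi y hyi ⟨A, hAt, hAa, hAw, hyA⟩
    exact (Finset.mem_sdiff.1 (hAs hyA)).2 (Finset.mem_insert_of_mem
      (Finset.mem_filter.2 ⟨hAt hyA, hyi, this⟩))) rfl
  have hKchain : ∀ y ∈ K, ∀ z ∈ K, y = z ∨ r y z ∨ r z y := by
    have below : ∀ y ∈ t.filter (fun z => f z = i ∧ (z = x i ∨ r z (x i))), r y a := fun y hy => by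
      obtain ⟨-, -, h | h⟩ := Finset.mem_filter.1 hy
      · exact h ▸ hia
      · exact _root_.trans (r := r) h hia
    intro y hy z hz
    rcases Finset.mem_insert.1 hy with rfl | hy
    · rcases Finset.mem_insert.1 hz with rfl | hz
      · exact Or.inl rfl
      · exact Or.inr (Or.inr (below z hz))
    · rcases Finset.mem_insert.1 hz with rfl | hz
      · exact Or.inr (Or.inl (below y hy))
      · obtain ⟨h1, h2, -⟩ := Finset.mem_filter.1 hy
        obtain ⟨h3, h4, -⟩ := Finset.mem_filter.1 hz
        exact hfc y h1 z h3 (h2.trans h4.symm)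
  refine ⟨fun y => if y ∈ K then w - 1 else g y, ?_, ?_⟩
  · intro y hy
    by_cases hyK : y ∈ K
    · simp only [hyK, if_true]; omega
    · have := hg y (Finset.mem_sdiff.2 ⟨hy, hyK⟩)
      simp only [hyK, if_false]; omega
  · intro y hy z hz hyz
    by_cases hyK : y ∈ K <;> by_cases hzK : z ∈ K
    · exact hKchain y hyK z hzK
    · have := hg z (Finset.mem_sdiff.2 ⟨hz, hzK⟩)
      simp only [hyK, hzK, if_true, if_false] at hyz; omega
    · have := hg y (Finset.mem_sdiff.2 ⟨hy, hyK⟩)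
      simp only [hyK, hzK, if_true, if_false] at hyz; omega
    · simp only [hyK, hzK, if_false] at hyz
      exact hgc y (Finset.mem_sdiff.2 ⟨hy, hyK⟩) z (Finset.mem_sdiff.2 ⟨hz, hzK⟩) hyz

open Classical in
/-- **Mirsky's theorem**: if the chains of a strict order have at most `w` elements, the order has a
height function with values less than `w`. -/
theorem exists_height {α : Type*} [Fintype α] (r : α → α → Prop) [IsStrictOrder α r] (w : ℕ)
    (hw : ∀ C : Finset α, (∀ x ∈ C, ∀ y ∈ C, x ≠ y → r x y ∨ r y x) → C.card ≤ w) :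
    ∃ h : α → ℕ, (∀ x, h x < w) ∧ ∀ x y, r x y → h x < h y := by
  set F : α → Finset (Finset α) := fun x => Finset.univ.filter fun C =>
    (∀ y ∈ C, ∀ z ∈ C, y ≠ z → r y z ∨ r z y) ∧ ∀ y ∈ C, r y x with hF
  have ext : ∀ x, ∀ C ∈ F x, insert x C ∈ Finset.univ.filter (fun C : Finset α =>
      ∀ y ∈ C, ∀ z ∈ C, y ≠ z → r y z ∨ r z y) ∧ (insert x C).card = C.card + 1 := by
    intro x C hC
    obtain ⟨-, h1, h2⟩ := Finset.mem_filter.1 hC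
    refine ⟨Finset.mem_filter.2 ⟨Finset.mem_univ _, ?_⟩, Finset.card_insert_of_notMem
      fun h => irrefl_of r x (h2 x h)⟩
    intro y hy z hz hyz
    rcases Finset.mem_insert.1 hy with rfl | hyC
    · rcases Finset.mem_insert.1 hz with rfl | hz
      · exact absurd rfl hyz
      · exact Or.inr (h2 z hz)
    · rcases Finset.mem_insert.1 hz with rfl | hz
      · exact Or.inl (h2 y hyC)
      · exact h1 y hyC z hz hyz
  have hne : ∀ x, (F x).Nonempty := fun x => ⟨∅, by simp [hF]⟩
  refine ⟨fun x => (F x).sup Finset.card, ?_, ?_⟩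
  · intro x
    obtain ⟨C, hC, he⟩ := Finset.exists_mem_eq_sup (F x) (hne x) Finset.card
    obtain ⟨h1, h2⟩ := ext x C hC
    have := hw _ (Finset.mem_filter.1 h1).2
    simp only [he]
    omega
  · intro x y hxy
    obtain ⟨C, hC, he⟩ := Finset.exists_mem_eq_sup (F x) (hne x) Finset.card
    obtain ⟨h1, h2⟩ := ext x C hC
    have hmem : insert x C ∈ F y := by
      refine Finset.mem_filter.2 ⟨Finset.mem_univ _, (Finset.mem_filter.1 h1).2, ?_⟩
      intro z hz
      rcases Finset.mem_insert.1 hz with rfl | hz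
      · exact hxy
      · exact _root_.trans (r := r) ((Finset.mem_filter.1 hC).2.2 z hz) hxy
    have := Finset.le_sup (f := Finset.card) hmem
    simp only [he]
    omega

open Classical in
/-- Two strict orders on more than `w ^ 3` elements, all of whose chains have at most `w` elements,
have a common antichain of more than `w` elements. -/
theorem exists_common_antichain {α : Type*} [Fintype α] (r₁ r₂ : α → α → Prop)
    [IsStrictOrder α r₁] [IsStrictOrder α r₂] (w : ℕ) (hα : w ^ 3 < Fintype.card α)
    (h₁ : ∀ C : Finset α, (∀ x ∈ C, ∀ y ∈ C, x ≠ y → r₁ x y ∨ r₁ y x) → C.card ≤ w)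
    (h₂ : ∀ C : Finset α, (∀ x ∈ C, ∀ y ∈ C, x ≠ y → r₂ x y ∨ r₂ y x) → C.card ≤ w) :
    ∃ A : Finset α, w < A.card ∧ ∀ x ∈ A, ∀ y ∈ A, ¬ r₁ x y ∧ ¬ r₂ x y := by
  obtain ⟨f, hf, hfr⟩ := exists_height r₁ w h₁
  obtain ⟨g, hg, hgr⟩ := exists_height r₂ w h₂
  obtain ⟨⟨i, j⟩, -, hij⟩ := Finset.exists_lt_card_fiber_of_mul_lt_card_of_maps_to
    (s := (Finset.univ : Finset α)) (t := Finset.range w ×ˢ Finset.range w)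
    (f := fun x => (f x, g x)) (n := w)
    (fun x _ => by simp [hf x, hg x])
    (by rw [Finset.card_product, Finset.card_range, Finset.card_univ]; linarith [pow_three' w])
  refine ⟨_, hij, ?_⟩
  intro x hx y hy
  have h1 := (Finset.mem_filter.1 hx).2
  have h2 := (Finset.mem_filter.1 hy).2
  simp only [Prod.mk.injEq] at h1 h2
  constructor
  · intro h
    have := hfr _ _ h
    omega
  · intro h
    have := hgr _ _ h
    omega

/-! ### Families of `x`-monotone curves grounded at a vertical line -/

/-- A family of `x`-monotone curves, indexed by `ι`, that run from points of a vertex set `V` to the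
right up to the vertical line `x = pos`. The curve with index `i` is the part of the graph of
`height i` over the interval from its starting vertex to `pos`. -/
structure GroundedFamily (ι V : Type*) where
  /-- The abscissa of the line on which the curves end. -/
  pos : ℝ
  /-- The point that represents a vertex. -/
  point : V → ℝ × ℝ
  /-- The vertex at which a curve starts. -/
  start : ι → V
  /-- The function whose graph contains a curve. -/
  height : ι → ℝ → ℝ
  point_injective : Function.Injective point
  continuous : ∀ i, Continuous (height i)
  height_start : ∀ i, height i (point (start i)).1 = (point (start i)).2
  start_lt : ∀ i, (point (start i)).1 < pos

namespace GroundedFamily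

variable {ι κ V : Type*} (H : GroundedFamily ι V)

/-- The abscissa of the starting point of a curve. -/
def left (i : ι) : ℝ := (H.point (H.start i)).1

/-- Two curves share a point that is not a starting point of either. Points on the line on which
the curves end count. -/
def Meets (i j : ι) : Prop :=
  ∃ x, H.left i < x ∧ H.left j < x ∧ x ≤ H.pos ∧ H.height i x = H.height j x

/-- The first curve lies below the second over the common part of their domains, starting points
excluded. -/
def Below (i j : ι) : Prop :=
  ∀ x, H.left i < x → H.left j < x → x ≤ H.pos → H.height i x < H.height j x

/-- The subfamily with indices given by a map `f`. -/
def comap (f : κ → ι) : GroundedFamily κ V where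
  pos := H.pos
  point := H.point
  start := H.start ∘ f
  height := H.height ∘ f
  point_injective := H.point_injective
  continuous i := H.continuous (f i)
  height_start i := H.height_start (f i)
  start_lt i := H.start_lt (f i)

variable {H}

theorem Meets.symm {i j : ι} (h : H.Meets i j) : H.Meets j i := by
  obtain ⟨x, h1, h2, h3, h4⟩ := h
  exact ⟨x, h2, h1, h3, h4.symm⟩

theorem Below.not_meets {i j : ι} (h : H.Below i j) : ¬ H.Meets i j := by
  rintro ⟨x, h1, h2, h3, h4⟩
  exact (h x h1 h2 h3).ne h4

theorem exists_height_eq {i j : ι} {x y : ℝ} (hx : H.height i x ≤ H.height j x)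
    (hy : H.height j y ≤ H.height i y) : ∃ z ∈ Set.uIcc x y, H.height i z = H.height j z := by
  have hc : ContinuousOn (fun z => H.height i z - H.height j z) (Set.uIcc x y) :=
    ((H.continuous i).sub (H.continuous j)).continuousOn
  obtain ⟨z, hz, hz0⟩ := intermediate_value_uIcc hc
    (show (0 : ℝ) ∈ _ from Set.mem_uIcc.2 (Or.inl ⟨sub_nonpos.2 hx, sub_nonneg.2 hy⟩))
  exact ⟨z, hz, sub_eq_zero.1 hz0⟩

/-- Curves that do not meet are ordered as their end points on the line. Curves with the same end
point meet. -/
theorem below_of_le {i j : ι} (hij : H.height i H.pos ≤ H.height j H.pos) (h : ¬ H.Meets i j) :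
    H.Below i j := by
  intro x hi hj hx
  by_contra hcon
  obtain ⟨z, hz, he⟩ := exists_height_eq hij (not_lt.1 hcon)
  rw [Set.uIcc_of_ge hx] at hz
  exact h ⟨z, hi.trans_le hz.1, hj.trans_le hz.1, hz.2, he⟩

/-- At the starting point of the shorter curve, `Below` still yields a weak inequality. -/
theorem Below.le {i j : ι} (h : H.Below i j) {x : ℝ} (hi : H.left i ≤ x) (hj : H.left j ≤ x)
    (hx : x ≤ H.pos) : H.height i x ≤ H.height j x := by
  by_contra hcon
  obtain ⟨z, hz, he⟩ := exists_height_eq (H := H) (i := j) (j := i) (not_le.1 hcon).le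
    (h H.pos (H.start_lt i) (H.start_lt j) le_rfl).le
  rw [Set.uIcc_of_le hx] at hz
  have hxz : x < z := lt_of_le_of_ne hz.1 (fun hxz => hcon (by rw [hxz, he]))
  exact (h z (hi.trans_lt hxz) (hj.trans_lt hxz) hz.2).ne he.symm

theorem below_trans {i j k : ι} (h1 : H.Below i j) (h2 : H.Below j k)
    (hj : H.left j ≤ H.left i ∨ H.left j ≤ H.left k) : H.Below i k := by
  intro x hi hk hx
  have hjx : H.left j < x := hj.elim (fun h => h.trans_lt hi) fun h => h.trans_lt hk
  exact (h1 x hi hjx hx).trans (h2 x hjx hk hx)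

theorem not_below_self (i : ι) : ¬ H.Below i i := fun h =>
  lt_irrefl _ (h H.pos (H.start_lt i) (H.start_lt i) le_rfl)

open Classical in
/-- If no more than `w` curves meet pairwise, then a subfamily with at least the fraction `1 / w` of
the curves has the property that curves from the same vertex do not meet. For the curves from one
vertex, being below is a strict order whose antichains are the families that meet pairwise. -/
theorem exists_disjoint_from_vertex [Finite ι] (w : ℕ)
    (hw : ∀ S : Finset ι, (S : Set ι).Pairwise H.Meets → S.card ≤ w) (S : Finset ι) :
    ∃ T ⊆ S, S.card ≤ w * T.card ∧
      ∀ i ∈ T, ∀ j ∈ T, i ≠ j → H.start i = H.start j → ¬ H.Meets i j := by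
  set r : ι → ι → Prop := fun i j => H.start i = H.start j ∧ H.Below i j with hr
  have : IsStrictOrder ι r :=
    { irrefl := fun i h => not_below_self i h.2
      trans := fun i j k h1 h2 => ⟨h1.1.trans h2.1, below_trans h1.2 h2.2
        (Or.inl (by simp only [left, h1.1]; exact le_rfl))⟩ }
  have col : ∀ v : V, ∃ f : ι → ℕ, (∀ x ∈ S.filter (fun i => H.start i = v), f x < w) ∧
      ∀ x ∈ S.filter (fun i => H.start i = v), ∀ y ∈ S.filter (fun i => H.start i = v),
        f x = f y → x = y ∨ r x y ∨ r y x := by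
    intro v
    refine exists_chain_coloring r _ w ?_
    intro A hA hAr
    refine hw A ?_
    intro i hi j hj hij
    have hi' := (Finset.mem_filter.1 (hA hi)).2
    have hj' := (Finset.mem_filter.1 (hA hj)).2
    by_contra hm
    rcases le_total (H.height i H.pos) (H.height j H.pos) with h | h
    · exact hAr i hi j hj ⟨hi'.trans hj'.symm, below_of_le h hm⟩
    · exact hAr j hj i hi ⟨hj'.trans hi'.symm, below_of_le h fun h => hm h.symm⟩
  choose f hf hfr using col
  have hmaps : ∀ i ∈ S, f (H.start i) i ∈ Finset.range w := fun i hi =>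
    Finset.mem_range.2 (hf _ i (Finset.mem_filter.2 ⟨hi, rfl⟩))
  rcases S.eq_empty_or_nonempty with rfl | ⟨i₀, hi₀⟩
  · exact ⟨∅, le_rfl, by simp, by simp⟩
  obtain ⟨c, -, hcmax⟩ := Finset.exists_max_image (Finset.range w)
    (fun c => (S.filter fun i => f (H.start i) i = c).card) ⟨_, hmaps i₀ hi₀⟩
  refine ⟨S.filter fun i => f (H.start i) i = c, Finset.filter_subset _ _, ?_, ?_⟩
  · rw [Finset.card_eq_sum_card_fiberwise hmaps]
    refine (Finset.sum_le_card_nsmul _ _ _ hcmax).trans ?_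
    rw [Finset.card_range, smul_eq_mul]
  · intro i hi j hj hij hv hm
    obtain ⟨hiS, hic⟩ := Finset.mem_filter.1 hi
    obtain ⟨hjS, hjc⟩ := Finset.mem_filter.1 hj
    rcases hfr (H.start j) i (Finset.mem_filter.2 ⟨hiS, hv⟩) j
      (Finset.mem_filter.2 ⟨hjS, rfl⟩) (by rw [hjc, ← hv, hic]) with h | h | h
    · exact hij h
    · exact h.2.not_meets hm
    · exact h.2.not_meets hm.symm

open Classical in
/-- The geometric heart of the argument: no long zigzag. From each of `l` vertices start three
curves `α`, `β`, `γ`, and on the line the `α`-curves come first, in increasing order, then the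
`β`-curves in decreasing order, then the `γ`-curves in increasing order. For `i < j` such that the
`β`-curves do not meet, the starting point that lies further to the right forces the `α`-curves
to meet (if it is the one of `i`) or the `γ`-curves to meet (if it is the one of `j`). -/
theorem zigzag_length_le (w : ℕ) (hw : ∀ S : Finset ι, (S : Set ι).Pairwise H.Meets → S.card ≤ w)
    (hdisj : ∀ i j, i ≠ j → H.start i = H.start j → ¬ H.Meets i j) (l : ℕ) (α β γ : Fin l → ι)
    (hαβ : ∀ t, H.start (α t) = H.start (β t)) (hβγ : ∀ t, H.start (β t) = H.start (γ t))
    (hinj : Function.Injective fun t => H.start (β t))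
    (neαβ : ∀ t, α t ≠ β t) (neβγ : ∀ t, β t ≠ γ t)
    (leαβ : ∀ t, H.height (α t) H.pos ≤ H.height (β t) H.pos)
    (leβγ : ∀ t, H.height (β t) H.pos ≤ H.height (γ t) H.pos)
    (hα : ∀ t u, t < u → H.height (α t) H.pos ≤ H.height (α u) H.pos)
    (hβ : ∀ t u, t < u → H.height (β u) H.pos ≤ H.height (β t) H.pos)
    (hγ : ∀ t u, t < u → H.height (γ t) H.pos ≤ H.height (γ u) H.pos) : l ≤ w ^ 3 := by
  have lα : ∀ t, H.left (α t) = H.left (β t) := fun t => by simp only [left, hαβ]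
  have lγ : ∀ t, H.left (γ t) = H.left (β t) := fun t => by simp only [left, hβγ]
  have vβ : ∀ t, H.height (β t) (H.left (β t)) = (H.point (H.start (β t))).2 := fun t =>
    H.height_start (β t)
  have vα : ∀ t, H.height (α t) (H.left (β t)) = (H.point (H.start (β t))).2 := fun t => by
    rw [← lα, ← hαβ]; exact H.height_start (α t)
  have vγ : ∀ t, H.height (γ t) (H.left (β t)) = (H.point (H.start (β t))).2 := fun t => by
    rw [← lγ, hβγ]; exact H.height_start (γ t)
  have bαβ : ∀ t, H.Below (α t) (β t) := fun t =>
    below_of_le (leαβ t) (hdisj _ _ (neαβ t) (hαβ t))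
  have bβγ : ∀ t, H.Below (β t) (γ t) := fun t =>
    below_of_le (leβγ t) (hdisj _ _ (neβγ t) (hβγ t))
  have hpos : ∀ t, H.left (β t) ≤ H.pos := fun t => (H.start_lt (β t)).le
  by_contra hl
  set r₁ : Fin l → Fin l → Prop := fun t u =>
    t < u ∧ H.left (β u) ≤ H.left (β t) ∧ H.Below (β u) (β t) with hr₁
  set r₂ : Fin l → Fin l → Prop := fun t u =>
    t < u ∧ H.left (β t) < H.left (β u) ∧ H.Below (β u) (β t) with hr₂
  have : IsStrictOrder (Fin l) r₁ :=
    { irrefl := fun t h => lt_irrefl _ h.1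
      trans := fun t u v h1 h2 => ⟨h1.1.trans h2.1, h2.2.1.trans h1.2.1,
        below_trans h2.2.2 h1.2.2 (Or.inr h1.2.1)⟩ }
  have : IsStrictOrder (Fin l) r₂ :=
    { irrefl := fun t h => lt_irrefl _ h.1
      trans := fun t u v h1 h2 => ⟨h1.1.trans h2.1, h1.2.1.trans h2.2.1,
        below_trans h2.2.2 h1.2.2 (Or.inl h2.2.1.le)⟩ }
  have m₁ : ∀ t u, r₁ t u → H.Meets (α t) (α u) := by
    rintro t u ⟨htu, hx, hb⟩
    by_contra hm
    have h1 := (below_of_le (hα t u htu) hm).le (x := H.left (β t)) (lα t).le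
      ((lα u).le.trans hx) (hpos t)
    have h2 := hb.le hx le_rfl (hpos t)
    rw [vα] at h1
    rw [vβ] at h2
    rcases hx.lt_or_eq with h | h
    · have := bαβ u (H.left (β t)) ((lα u).trans_lt h) h (hpos t)
      linarith
    · rw [← h, vα] at h1
      rw [← h, vβ] at h2
      refine htu.ne' (hinj (H.point_injective (Prod.ext h ?_)))
      exact le_antisymm h2 h1
  have m₂ : ∀ t u, r₂ t u → H.Meets (γ t) (γ u) := by
    rintro t u ⟨htu, hx, hb⟩
    by_contra hm
    have h1 := (below_of_le (hγ t u htu) hm).le (x := H.left (β u)) ((lγ t).le.trans hx.le)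
      (lγ u).le (hpos u)
    have h2 := hb.le le_rfl hx.le (hpos u)
    have h3 := bβγ t (H.left (β u)) hx ((lγ t).trans_lt hx) (hpos u)
    rw [vγ] at h1
    rw [vβ] at h2
    linarith
  -- a set of indices for which one of the three kinds of curves meets pairwise is small
  have small : ∀ δ : Fin l → ι, (∀ t, H.start (δ t) = H.start (β t)) → ∀ C : Finset (Fin l),
      (∀ x ∈ C, ∀ y ∈ C, x ≠ y → H.Meets (δ x) (δ y) ∨ H.Meets (δ y) (δ x)) → C.card ≤ w := by
    intro δ hδ C hC
    have hδinj : Function.Injective δ := fun t u h => hinj (by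
      simp only [← hδ, h])
    rw [← Finset.card_image_of_injective C hδinj]
    refine hw _ ?_
    intro i hi j hj hij
    obtain ⟨t, ht, rfl⟩ := Finset.mem_image.1 (Finset.mem_coe.1 hi)
    obtain ⟨u, hu, rfl⟩ := Finset.mem_image.1 (Finset.mem_coe.1 hj)
    exact (hC t ht u hu (fun h => hij (h ▸ rfl))).elim id Meets.symm
  obtain ⟨A, hA, hAr⟩ := exists_common_antichain r₁ r₂ w (by simpa using hl)
    (fun C hC => small α hαβ C fun x hx y hy hxy => (hC x hx y hy hxy).imp (m₁ _ _) (m₁ _ _))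
    (fun C hC => small γ (fun t => (hβγ t).symm) C fun x hx y hy hxy =>
      (hC x hx y hy hxy).imp (m₂ _ _) (m₂ _ _))
  have mβ : ∀ t ∈ A, ∀ u ∈ A, t < u → H.Meets (β u) (β t) := by
    intro t ht u hu htu
    by_contra hm
    have hb := below_of_le (hβ t u htu) hm
    rcases le_or_gt (H.left (β u)) (H.left (β t)) with h | h
    · exact (hAr t ht u hu).1 ⟨htu, h, hb⟩
    · exact (hAr t ht u hu).2 ⟨htu, h, hb⟩
  have := small β (fun _ => rfl) A fun t ht u hu htu => by
    rcases lt_or_gt_of_ne htu with h | h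
    · exact Or.inr (mβ t ht u hu h)
    · exact Or.inl (mβ u hu t ht h)
  omega

open Classical in
/-- Suppose the curves are indexed in the order of their end points, and curves from the same vertex
do not meet. Divide the curves into at most `m` blocks of `s` consecutive ones. Then the number of
incidences between starting vertices and blocks is linear: in the matrix with a row for each vertex,
ranked by its last occurrence, and a column for each block, a nest together with the last
occurrences is a zigzag. -/
theorem card_incidences_le {N : ℕ} (H : GroundedFamily (Fin N) V) (w : ℕ)
    (hw : ∀ S : Finset (Fin N), (S : Set (Fin N)).Pairwise H.Meets → S.card ≤ w)
    (hdisj : ∀ i j, i ≠ j → H.start i = H.start j → ¬ H.Meets i j)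
    (hmono : ∀ i j, i ≤ j → H.height i H.pos ≤ H.height j H.pos)
    (W : Finset V) (hW : ∀ i, H.start i ∈ W) (s m : ℕ) (hm : N ≤ s * m) :
    (Finset.univ.image fun i : Fin N => (H.start i, i.val / s)).card ≤
      6 ^ (w ^ 3 + 1) * (W.card + m) + W.card := by
  set last : V → ℕ := fun v =>
    (Finset.univ.filter fun i : Fin N => H.start i = v).sup fun i => i.val with hlast
  have le_last : ∀ i : Fin N, i.val ≤ last (H.start i) := fun i =>
    Finset.le_sup (f := fun i : Fin N => i.val) (Finset.mem_filter.2 ⟨Finset.mem_univ i, rfl⟩)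
  have last_mem : ∀ i : Fin N, ∃ j : Fin N, H.start j = H.start i ∧ j.val = last (H.start i) := by
    intro i
    obtain ⟨j, hj, he⟩ := Finset.exists_mem_eq_sup
      (Finset.univ.filter fun j : Fin N => H.start j = H.start i) ⟨i, by simp⟩ fun j => j.val
    exact ⟨j, (Finset.mem_filter.1 hj).2, he.symm⟩
  have last_inj : ∀ i j : Fin N, last (H.start i) = last (H.start j) →
      H.start i = H.start j := by
    intro i j h
    obtain ⟨i', hi, hi'⟩ := last_mem i
    obtain ⟨j', hj, hj'⟩ := last_mem j
    have : i' = j' := Fin.ext (by omega)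
    rw [← hi, ← hj, this]
  set L := Finset.univ.filter fun i : Fin N => i.val < last (H.start i) with hL
  set M : Finset (ℕ × ℕ) := L.image fun i => (last (H.start i), i.val / s) with hM
  have hnest : ∀ a c d, ¬ IsNest M (w ^ 3 + 1) a c d := by
    intro a c d hn
    have hl : ∀ t : Fin (w ^ 3 + 1), ∃ i : Fin N, i.val < last (H.start i) ∧
        last (H.start i) = a t ∧ i.val / s = c t := fun t => by
      obtain ⟨i, hi, he⟩ := Finset.mem_image.1 (hn.mem_left t t.2)
      rw [Prod.mk.injEq] at he
      exact ⟨i, (Finset.mem_filter.1 hi).2, he⟩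
    have hr : ∀ t : Fin (w ^ 3 + 1), ∃ i : Fin N, i.val < last (H.start i) ∧
        last (H.start i) = a t ∧ i.val / s = d t := fun t => by
      obtain ⟨i, hi, he⟩ := Finset.mem_image.1 (hn.mem_right t t.2)
      rw [Prod.mk.injEq] at he
      exact ⟨i, (Finset.mem_filter.1 hi).2, he⟩
    choose α hαlt hαa hαc using hl
    choose β hβlt hβa hβd using hr
    choose γ hγs hγv using fun t => last_mem (β t)
    have lt_of_div : ∀ i j : Fin N, i.val / s < j.val / s → i < j := fun i j h => by
      by_contra hcon
      exact absurd (Nat.div_le_div_right (c := s) (Fin.le_def.1 (not_lt.1 hcon))) (by omega)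
    have ltαβ : ∀ t, α t < β t := fun t => lt_of_div _ _ (by
      rw [hαc, hβd]; exact hn.lt t t.2)
    have ltβγ : ∀ t, β t < γ t := fun t => Fin.lt_def.2 (by rw [hγv]; exact hβlt t)
    have := zigzag_length_le w hw hdisj (w ^ 3 + 1) α β γ
      (fun t => last_inj _ _ ((hαa t).trans (hβa t).symm)) (fun t => (hγs t).symm)
      (fun t u h => by
        have h' : a t = a u := by rw [← hβa, ← hβa]; exact congrArg last h
        rcases lt_trichotomy t u with h1 | h1 | h1
        · exact absurd h' (hn.row_lt t u h1 u.2).ne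
        · exact h1
        · exact absurd h' (hn.row_lt u t h1 t.2).ne')
      (fun t => (ltαβ t).ne) (fun t => (ltβγ t).ne)
      (fun t => hmono _ _ (ltαβ t).le) (fun t => hmono _ _ (ltβγ t).le)
      (fun t u h => hmono _ _ (lt_of_div _ _ (by
        rw [hαc, hαc]; exact hn.left_lt t u h u.2)).le)
      (fun t u h => hmono _ _ (lt_of_div _ _ (by
        rw [hβd, hβd]; exact hn.right_lt t u h u.2)).le)
      (fun t u h => hmono _ _ (Fin.le_def.2 (by
        rw [hγv, hγv, hβa, hβa]; exact (hn.row_lt t u h u.2).le)))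
    omega
  have hMcard := card_le_of_not_isNest (w ^ 3) M hnest
  have hrows : (M.image Prod.fst).card ≤ W.card := by
    refine (Finset.card_le_card (t := W.image last) ?_).trans Finset.card_image_le
    intro x hx
    obtain ⟨o, ho, rfl⟩ := Finset.mem_image.1 hx
    obtain ⟨i, -, rfl⟩ := Finset.mem_image.1 ho
    exact Finset.mem_image_of_mem _ (hW i)
  have hcols : (M.image Prod.snd).card ≤ m := by
    rw [← Finset.card_range m]
    refine Finset.card_le_card ?_
    intro x hx
    obtain ⟨o, ho, rfl⟩ := Finset.mem_image.1 hx
    obtain ⟨i, -, rfl⟩ := Finset.mem_image.1 ho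
    exact Finset.mem_range.2 (Nat.div_lt_of_lt_mul (i.2.trans_le hm))
  have hsplit : (Finset.univ.image fun i : Fin N => (H.start i, i.val / s)) ⊆
      (L.image fun i => (H.start i, i.val / s)) ∪
        (Finset.univ.filter fun i : Fin N => i.val = last (H.start i)).image
          fun i => (H.start i, i.val / s) := by
    intro o ho
    obtain ⟨i, -, rfl⟩ := Finset.mem_image.1 ho
    rcases (le_last i).lt_or_eq with h | h
    · exact Finset.mem_union_left _ (Finset.mem_image_of_mem _ (by simpa [hL] using h))
    · exact Finset.mem_union_right _ (Finset.mem_image_of_mem _ (by simpa using h))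
  have h1 : (L.image fun i => (H.start i, i.val / s)).card ≤ M.card := by
    refine Finset.card_le_card_of_injOn (fun o => (last o.1, o.2)) ?_ ?_
    · intro o ho
      obtain ⟨i, hi, rfl⟩ := Finset.mem_image.1 (Finset.mem_coe.1 ho)
      exact Finset.mem_coe.2 (Finset.mem_image.2 ⟨i, hi, rfl⟩)
    · intro o ho o' ho' he
      obtain ⟨i, hi, rfl⟩ := Finset.mem_image.1 (Finset.mem_coe.1 ho)
      obtain ⟨j, hj, rfl⟩ := Finset.mem_image.1 (Finset.mem_coe.1 ho')
      simp only [Prod.mk.injEq] at he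
      exact Prod.ext (last_inj i j he.1) he.2
  have h2 : ((Finset.univ.filter fun i : Fin N => i.val = last (H.start i)).image
      fun i => (H.start i, i.val / s)).card ≤ W.card := by
    refine Finset.card_image_le.trans ?_
    refine Finset.card_le_card_of_injOn H.start (fun i _ => hW i) ?_
    intro i hi j hj he
    have hi' := (Finset.mem_filter.1 (Finset.mem_coe.1 hi)).2
    have hj' := (Finset.mem_filter.1 (Finset.mem_coe.1 hj)).2
    exact Fin.ext (by rw [hi', hj', he])
  have h3 : M.card ≤ 6 ^ (w ^ 3 + 1) * (W.card + m) :=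
    hMcard.trans (Nat.mul_le_mul_left _ (by omega))
  have h4 := (Finset.card_le_card hsplit).trans (Finset.card_union_le _ _)
  omega

open Classical in
/-- The linear bound for curves that cross a vertical line, after curves from a common vertex have
been made disjoint on either side of the line: a block of `r ^ 2` curves has at least `r` different
starting vertices on one of the two sides. -/
theorem card_le_of_disjoint {N : ℕ} (L R : GroundedFamily (Fin N) V) (w : ℕ)
    (hLw : ∀ S : Finset (Fin N), (S : Set (Fin N)).Pairwise L.Meets → S.card ≤ w)
    (hRw : ∀ S : Finset (Fin N), (S : Set (Fin N)).Pairwise R.Meets → S.card ≤ w)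
    (hL : ∀ i j, i ≠ j → L.start i = L.start j → ¬ L.Meets i j)
    (hR : ∀ i j, i ≠ j → R.start i = R.start j → ¬ R.Meets i j)
    (hLmono : ∀ i j, i ≤ j → L.height i L.pos ≤ L.height j L.pos)
    (hRmono : ∀ i j, i ≤ j → R.height i R.pos ≤ R.height j R.pos)
    (hinj : Function.Injective fun i => (L.start i, R.start i))
    (W : Finset V) (hLW : ∀ i, L.start i ∈ W) (hRW : ∀ i, R.start i ∈ W) :
    N ≤ 16 * (6 ^ (w ^ 3 + 1)) ^ 2 * (2 * W.card + 2) := by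
  set p := 6 ^ (w ^ 3 + 1) with hp
  have hp1 : 1 ≤ p := Nat.one_le_pow _ _ (by norm_num)
  set r := 4 * p with hr
  set s := r ^ 2 with hs
  have hspos : 0 < s := by positivity
  set m := N / s with hm
  have hNm : N < s * (m + 1) := Nat.lt_mul_div_succ N hspos
  have hmN : s * m ≤ N := Nat.mul_div_le N s
  have iL := card_incidences_le L w hLw hL hLmono W hLW s (m + 1) hNm.le
  have iR := card_incidences_le R w hRw hR hRmono W hRW s (m + 1) hNm.le
  rw [← hp] at iL iR
  set IL := Finset.univ.image fun i : Fin N => (L.start i, i.val / s) with hIL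
  set IR := Finset.univ.image fun i : Fin N => (R.start i, i.val / s) with hIR
  have fib : ∀ I : Finset (V × ℕ),
      ∑ j ∈ Finset.range m, (I.filter fun o => o.2 = j).card ≤ I.card := by
    intro I
    rw [← Finset.card_biUnion (by
      intro j _ j' _ hjj'
      refine Finset.disjoint_left.2 fun o ho ho' => hjj' ?_
      exact (Finset.mem_filter.1 ho).2.symm.trans (Finset.mem_filter.1 ho').2)]
    refine Finset.card_le_card fun o ho => ?_
    obtain ⟨j, -, hj⟩ := Finset.mem_biUnion.1 ho
    exact (Finset.mem_filter.1 hj).1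
  have block : ∀ j ∈ Finset.range m,
      r ≤ (IL.filter fun o => o.2 = j).card + (IR.filter fun o => o.2 = j).card := by
    intro j hj
    have hj' : (j + 1) * s ≤ N :=
      (Nat.mul_le_mul_right s (Finset.mem_range.1 hj)).trans (by rw [mul_comm]; exact hmN)
    have hb : s ≤ (IL.filter fun o => o.2 = j).card * (IR.filter fun o => o.2 = j).card := by
      rw [← Finset.card_product]
      set f : Fin s → Fin N := fun q => ⟨j * s + q.val, by
        have := q.2
        rw [add_mul, one_mul] at hj'
        omega⟩ with hf
      have hfdiv : ∀ q, (f q).val / s = j := fun q => by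
        simp only [hf]
        rw [mul_comm, Nat.mul_add_div hspos, Nat.div_eq_of_lt q.2, add_zero]
      have := Finset.card_le_card_of_injOn (s := (Finset.univ : Finset (Fin s)))
        (t := (IL.filter fun o => o.2 = j) ×ˢ (IR.filter fun o => o.2 = j))
        (fun q => ((L.start (f q), j), (R.start (f q), j))) (by
          intro q _
          refine Finset.mem_coe.2 (Finset.mem_product.2 ⟨?_, ?_⟩)
          · exact Finset.mem_filter.2 ⟨Finset.mem_image.2 ⟨f q, Finset.mem_univ _, by
              rw [hfdiv]⟩, rfl⟩
          · exact Finset.mem_filter.2 ⟨Finset.mem_image.2 ⟨f q, Finset.mem_univ _, by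
              rw [hfdiv]⟩, rfl⟩) (by
          intro q _ q' _ he
          simp only [Prod.mk.injEq, and_true] at he
          have := hinj (Prod.ext he.1 he.2)
          simp only [hf, Fin.mk.injEq] at this
          exact Fin.ext (by omega))
      simpa using this
    by_contra hcon
    push Not at hcon
    set A := (IL.filter fun o => o.2 = j).card
    set B := (IR.filter fun o => o.2 = j).card
    have : A * B < r ^ 2 := by nlinarith
    omega
  have hsum : m * r ≤ IL.card + IR.card := by
    have h1 := Finset.card_nsmul_le_sum _ _ _ block
    rw [Finset.sum_add_distrib, Finset.card_range, smul_eq_mul] at h1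
    exact h1.trans (Nat.add_le_add (fib IL) (fib IR))
  have hm2 : m ≤ 2 * W.card + 1 := by
    have h1 : m * (4 * p) ≤ 2 * (p * (W.card + (m + 1)) + W.card) := by
      rw [← hr]; omega
    have h2 : W.card ≤ p * W.card := Nat.le_mul_of_pos_left _ hp1
    have h3 : p * m ≤ p * (2 * W.card + 1) := by nlinarith
    exact Nat.le_of_mul_le_mul_left h3 hp1
  calc N ≤ s * (m + 1) := hNm.le
    _ ≤ s * (2 * W.card + 2) := Nat.mul_le_mul_left _ (by omega)
    _ = 16 * p ^ 2 * (2 * W.card + 2) := by rw [hs, hr]; ring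

open Classical in
/-- A family of `x`-monotone curves that cross a vertical line, given by the parts on the two sides
of the line, has at most linearly many members if no more than `w` of them meet pairwise on
either side. -/
theorem card_le_of_crossing_line [Fintype ι] (L R : GroundedFamily ι V) (w : ℕ)
    (hLw : ∀ S : Finset ι, (S : Set ι).Pairwise L.Meets → S.card ≤ w)
    (hRw : ∀ S : Finset ι, (S : Set ι).Pairwise R.Meets → S.card ≤ w)
    (hLR : ∀ i, L.height i L.pos = R.height i R.pos)
    (hinj : Function.Injective fun i => (L.start i, R.start i))
    (W : Finset V) (hLW : ∀ i, L.start i ∈ W) (hRW : ∀ i, R.start i ∈ W) :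
    Fintype.card ι ≤ w * (w * (16 * (6 ^ (w ^ 3 + 1)) ^ 2 * (2 * W.card + 2))) := by
  obtain ⟨T, -, hT, hTd⟩ := L.exists_disjoint_from_vertex w hLw Finset.univ
  obtain ⟨U, hUT, hU, hUd⟩ := R.exists_disjoint_from_vertex w hRw T
  rw [Finset.card_univ] at hT
  refine hT.trans (Nat.mul_le_mul_left _ (hU.trans (Nat.mul_le_mul_left _ ?_)))
  set e : Fin U.card ≃ U := U.equivFin.symm with he
  set σ := Tuple.sort fun i => L.height (e i) L.pos with hσ
  have hmono : Monotone fun i => L.height (e (σ i)) L.pos :=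
    Tuple.monotone_sort fun i => L.height (e i) L.pos
  set f : Fin U.card → ι := fun i => e (σ i) with hf
  have hfinj : Function.Injective f := fun i j h => σ.injective (e.injective (Subtype.ext h))
  have hfU : ∀ i, f i ∈ U := fun i => (e (σ i)).2
  have clique : ∀ H : GroundedFamily ι V,
      (∀ S : Finset ι, (S : Set ι).Pairwise H.Meets → S.card ≤ w) →
      ∀ S : Finset (Fin U.card), (S : Set (Fin U.card)).Pairwise (H.comap f).Meets →
        S.card ≤ w := by
    intro H hH S hS
    rw [← Finset.card_image_of_injective S hfinj]
    refine hH _ ?_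
    intro i hi j hj hij
    obtain ⟨t, ht, rfl⟩ := Finset.mem_image.1 (Finset.mem_coe.1 hi)
    obtain ⟨u, hu, rfl⟩ := Finset.mem_image.1 (Finset.mem_coe.1 hj)
    exact hS ht hu fun h => hij (h ▸ rfl)
  refine card_le_of_disjoint (L.comap f) (R.comap f) w (clique L hLw) (clique R hRw)
    (fun i j hij hv => hTd _ (hUT (hfU i)) _ (hUT (hfU j)) (hfinj.ne hij) hv)
    (fun i j hij hv => hUd _ (hfU i) _ (hfU j) (hfinj.ne hij) hv)
    (fun i j hij => hmono hij) (fun i j hij => ?_)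
    (fun i j h => hfinj (hinj h)) W (fun i => hLW _) (fun i => hRW _)
  have := hmono hij
  simp only [hLR] at this
  exact this

end GroundedFamily

/-! ### Drawings with `x`-monotone edges -/

namespace TopologicalGraph

variable {V : Type*} {D : TopologicalGraph V}

/-- An `x`-monotone edge, oriented from left to right, is part of the graph of a function that is
continuous on the whole line (by Tietze's extension theorem). -/
theorem IsXMonotone.exists_height (hD : D.IsXMonotone) (e : D.graph.edgeSet) :
    ∃ (u v : V) (g : ℝ → ℝ), (e : Sym2 V) = s(u, v) ∧ (D.point u).1 < (D.point v).1 ∧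
      Continuous g ∧ g (D.point u).1 = (D.point u).2 ∧ g (D.point v).1 = (D.point v).2 ∧
      ∀ x, (D.point u).1 < x → x < (D.point v).1 → (x, g x) ∈ arcInterior (D.curve e) := by
  set φ : unitInterval → ℝ := fun t => (D.curve e t).1 with hφ
  have hφc : Continuous φ := continuous_fst.comp (D.curve e).continuous
  have hφi : Function.Injective φ := fun a b h =>
    D.curve_injective e (hD e _ ⟨a, rfl⟩ _ ⟨b, rfl⟩ h)
  obtain ⟨g, hg⟩ := ContinuousMap.exists_extension' (hφc.isClosedEmbedding hφi)
    (⟨fun t => (D.curve e t).2, continuous_snd.comp (D.curve e).continuous⟩ : C(unitInterval, ℝ))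
  have hg' : ∀ t, g (φ t) = (D.curve e t).2 := fun t => congrFun hg t
  have main : ∀ a b : unitInterval, ({a, b} : Set unitInterval) = {0, 1} → ∀ u v : V,
      D.curve e a = D.point u → D.curve e b = D.point v → (e : Sym2 V) = s(u, v) →
      φ a < φ b → ∃ (u v : V) (g : ℝ → ℝ), (e : Sym2 V) = s(u, v) ∧
      (D.point u).1 < (D.point v).1 ∧
      Continuous g ∧ g (D.point u).1 = (D.point u).2 ∧ g (D.point v).1 = (D.point v).2 ∧
      ∀ x, (D.point u).1 < x → x < (D.point v).1 → (x, g x) ∈ arcInterior (D.curve e) := by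
    intro a b hab u v hu hv he hlt
    refine ⟨u, v, g, he, ?_, g.continuous, ?_, ?_, ?_⟩
    · rw [← hu, ← hv]; exact hlt
    · rw [← hu]; exact hg' a
    · rw [← hv]; exact hg' b
    · intro x hux hxv
      rw [← hu] at hux
      rw [← hv] at hxv
      obtain ⟨t, rfl⟩ := mem_range_of_exists_le_of_exists_ge hφc ⟨a, hux.le⟩ ⟨b, hxv.le⟩
      have hta : t ≠ a := fun h => by simp [hφ, h] at hux
      have htb : t ≠ b := fun h => by simp [hφ, h] at hxv
      have ht : t ∉ ({0, 1} : Set unitInterval) := by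
        rw [← hab]
        simp [hta, htb]
      simp only [Set.mem_insert_iff, Set.mem_singleton_iff, not_or] at ht
      refine ⟨t, ⟨unitInterval.pos_iff_ne_zero.2 ht.1, unitInterval.lt_one_iff_ne_one.2 ht.2⟩, ?_⟩
      exact Prod.ext rfl (hg' t).symm
  have hends := D.curve_ends e
  obtain ⟨u, v, he⟩ : ∃ u v, (e : Sym2 V) = s(u, v) := by
    induction h : (e : Sym2 V) using Sym2.ind with
    | _ u v => exact ⟨u, v, rfl⟩
  rw [he, Sym2.map_mk, Sym2.eq_iff] at hends
  have hne : φ 0 ≠ φ 1 := hφi.ne zero_ne_one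
  rcases hends with ⟨h0, h1⟩ | ⟨h0, h1⟩
  · rcases hne.lt_or_gt with h | h
    · exact main 0 1 rfl u v h0 h1 he h
    · exact main 1 0 (Set.pair_comm _ _) v u h1 h0 (he.trans Sym2.eq_swap) h
  · rcases hne.lt_or_gt with h | h
    · exact main 0 1 rfl v u h0 h1 (he.trans Sym2.eq_swap) h
    · exact main 1 0 (Set.pair_comm _ _) u v h1 h0 he h

/-- The left end `tail e`, the right end `head e`, and for every edge a continuous function whose
graph contains it. -/
structure HeightFunctions (D : TopologicalGraph V) where
  /-- The left end of an edge. -/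
  tail : D.graph.edgeSet → V
  /-- The right end of an edge. -/
  head : D.graph.edgeSet → V
  /-- A function whose graph contains the edge. -/
  height : D.graph.edgeSet → ℝ → ℝ
  edge_eq : ∀ e : D.graph.edgeSet, (e : Sym2 V) = s(tail e, head e)
  tail_lt_head : ∀ e, (D.point (tail e)).1 < (D.point (head e)).1
  continuous : ∀ e, Continuous (height e)
  height_tail : ∀ e, height e (D.point (tail e)).1 = (D.point (tail e)).2
  height_head : ∀ e, height e (D.point (head e)).1 = (D.point (head e)).2
  mem_arcInterior : ∀ e x, (D.point (tail e)).1 < x → x < (D.point (head e)).1 →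
    (x, height e x) ∈ arcInterior (D.curve e)

theorem IsXMonotone.nonempty_heightFunctions (hD : D.IsXMonotone) :
    Nonempty D.HeightFunctions := by
  choose u v g h1 h2 h3 h4 h5 h6 using hD.exists_height
  exact ⟨⟨u, v, g, h1, h2, h3, h4, h5, h6⟩⟩

namespace HeightFunctions

variable (F : D.HeightFunctions)

/-- The parts of some edges to the left of the line `x = a`, which they cross. -/
def leftPart (S : Finset D.graph.edgeSet) (a : ℝ) (ha : ∀ e ∈ S, (D.point (F.tail e)).1 < a) :
    GroundedFamily S V where
  pos := a
  point := D.point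
  start e := F.tail e
  height e := F.height e
  point_injective := D.point_injective
  continuous e := F.continuous e
  height_start e := F.height_tail e
  start_lt e := ha e e.2

/-- The parts of some edges to the right of the line `x = a`, which they cross, reflected so that
they run to the right. -/
def rightPart (S : Finset D.graph.edgeSet) (a : ℝ) (ha : ∀ e ∈ S, a < (D.point (F.head e)).1) :
    GroundedFamily S V where
  pos := -a
  point v := (-(D.point v).1, (D.point v).2)
  start e := F.head e
  height e x := F.height e (-x)
  point_injective u v h := by
    simp only [Prod.mk.injEq, neg_inj] at h
    exact D.point_injective (Prod.ext h.1 h.2)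
  continuous e := (F.continuous e).comp continuous_neg
  height_start e := by
    simp only [neg_neg]
    exact F.height_head e
  start_lt e := neg_lt_neg (ha e e.2)

theorem cross_of_eq {e f : D.graph.edgeSet} {x : ℝ} (h1 : (D.point (F.tail e)).1 < x)
    (h2 : x < (D.point (F.head e)).1) (h3 : (D.point (F.tail f)).1 < x)
    (h4 : x < (D.point (F.head f)).1) (h : F.height e x = F.height f x) : D.Cross e f :=
  ⟨(x, F.height e x), F.mem_arcInterior e x h1 h2, h ▸ F.mem_arcInterior f x h3 h4⟩

open Classical in
theorem card_le_of_pairwise_cross {w : ℕ} (hD : D.IsQuasiPlanar (w + 1))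
    (S : Finset D.graph.edgeSet) (T : Finset S)
    (hT : ∀ e ∈ T, ∀ f ∈ T, e ≠ f → D.Cross e f) : T.card ≤ w := by
  by_contra hcon
  obtain ⟨U, hUT, hU⟩ := Finset.exists_subset_card_eq (show w + 1 ≤ T.card by omega)
  refine hD ⟨U.map (Function.Embedding.subtype _), by simpa using hU, ?_⟩
  intro e he f hf hef
  obtain ⟨e', he', rfl⟩ := Finset.mem_map.1 (Finset.mem_coe.1 he)
  obtain ⟨f', hf', rfl⟩ := Finset.mem_map.1 (Finset.mem_coe.1 hf)
  exact hT e' (hUT he') f' (hUT hf') fun h => hef (h ▸ rfl)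

/-- Linearly many edges cross a vertical line. -/
theorem card_crossing_line_le {w : ℕ} (hD : D.IsQuasiPlanar (w + 1)) (W : Finset V)
    (S : Finset D.graph.edgeSet) (hS : ∀ e ∈ S, F.tail e ∈ W ∧ F.head e ∈ W) (a : ℝ)
    (ha : ∀ e ∈ S, (D.point (F.tail e)).1 < a ∧ a < (D.point (F.head e)).1) :
    S.card ≤ w * (w * (16 * (6 ^ (w ^ 3 + 1)) ^ 2 * (2 * W.card + 2))) := by
  have h := GroundedFamily.card_le_of_crossing_line (F.leftPart S a fun e he => (ha e he).1)
    (F.rightPart S a fun e he => (ha e he).2) w ?_ ?_ ?_ ?_ W (fun e => (hS e e.2).1)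
    (fun e => (hS e e.2).2)
  · simpa using h
  · intro T hT
    refine card_le_of_pairwise_cross hD S T fun e he f hf hef => ?_
    obtain ⟨x, h1, h2, h3, h4⟩ := hT he hf hef
    exact F.cross_of_eq h1 (lt_of_le_of_lt h3 (ha e e.2).2) h2 (lt_of_le_of_lt h3 (ha f f.2).2) h4
  · intro T hT
    refine card_le_of_pairwise_cross hD S T fun e he f hf hef => ?_
    obtain ⟨x, h1, h2, h3, h4⟩ := hT he hf hef
    have h3' : a ≤ -x := le_neg.1 h3
    exact F.cross_of_eq ((ha e e.2).1.trans_le h3') (neg_lt.1 h1) ((ha f f.2).1.trans_le h3')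
      (neg_lt.1 h2) h4
  · intro e
    simp [leftPart, rightPart]
  · intro e f h
    simp only [leftPart, rightPart, Prod.mk.injEq] at h
    refine Subtype.ext (Subtype.ext ?_)
    rw [F.edge_eq, F.edge_eq, h.1, h.2]

end HeightFunctions

end TopologicalGraph

/-! ### Divide and conquer -/

open Classical in
/-- A median: at most half of the values lie strictly on either side of it. -/
theorem exists_median {V : Type*} (x : V → ℝ) (W : Finset V) (hW : W.Nonempty) :
    ∃ t, 2 * (W.filter fun v => x v < t).card ≤ W.card ∧
      2 * (W.filter fun v => t < x v).card ≤ W.card := by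
  obtain ⟨m, hm, hmax⟩ := Finset.exists_max_image W x hW
  obtain ⟨q, hq, hqmin⟩ := Finset.exists_min_image
    (W.filter fun q => W.card ≤ 2 * (W.filter fun v => x v ≤ x q).card) x
    ⟨m, Finset.mem_filter.2 ⟨hm, by rw [Finset.filter_true_of_mem hmax]; omega⟩⟩
  obtain ⟨hqW, hqc⟩ := Finset.mem_filter.1 hq
  refine ⟨x q, ?_, ?_⟩
  · rcases (W.filter fun v => x v < x q).eq_empty_or_nonempty with he | hne
    · simp [he]
    obtain ⟨p, hp, hpmax⟩ := Finset.exists_max_image _ x hne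
    obtain ⟨hpW, hpq⟩ := Finset.mem_filter.1 hp
    by_contra hcon
    have hsub : (W.filter fun v => x v < x q) ⊆ W.filter fun v => x v ≤ x p := fun v hv =>
      Finset.mem_filter.2 ⟨(Finset.mem_filter.1 hv).1, hpmax v hv⟩
    have := hqmin p (Finset.mem_filter.2 ⟨hpW, by
      have := Finset.card_le_card hsub
      omega⟩)
    linarith
  · have h := Finset.card_filter_add_card_filter_not (s := W) (fun v => x v ≤ x q)
    simp only [not_le] at h
    omega

namespace TopologicalGraph.HeightFunctions

variable {V : Type*} {D : TopologicalGraph V} (F : D.HeightFunctions)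

open Classical Topology in
/-- Split the vertices at a vertical line through a median. The edges that neither stay strictly to
the left nor strictly to the right of it cross a vertical line slightly to its right or slightly to
its left. -/
theorem card_edges_le {w : ℕ} (hD : D.IsQuasiPlanar (w + 1))
    (S : Finset D.graph.edgeSet) (W : Finset V) (hS : ∀ e ∈ S, F.tail e ∈ W ∧ F.head e ∈ W) :
    S.card ≤ 8 * (w * (w * (16 * (6 ^ (w ^ 3 + 1)) ^ 2))) * (W.card * Nat.log 2 W.card) := by
  induction hn : W.card using Nat.strong_induction_on generalizing W S with
  | _ n ih =>
  subst hn
  set C := w * (w * (16 * (6 ^ (w ^ 3 + 1)) ^ 2)) with hC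
  have hCW : ∀ n, w * (w * (16 * (6 ^ (w ^ 3 + 1)) ^ 2 * (2 * n + 2))) = C * (2 * n + 2) :=
    fun n => by rw [hC]; ring
  rcases S.eq_empty_or_nonempty with rfl | ⟨e₀, he₀⟩
  · simp
  have hW2 : 2 ≤ W.card := by
    refine Finset.one_lt_card.2 ⟨_, (hS e₀ he₀).1, _, (hS e₀ he₀).2, fun h => ?_⟩
    have := F.tail_lt_head e₀
    rw [h] at this
    exact lt_irrefl _ this
  obtain ⟨t, ht1, ht2⟩ := exists_median (fun v => (D.point v).1) W ⟨_, (hS e₀ he₀).1⟩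
  set W₁ := W.filter fun v => (D.point v).1 < t with hW₁
  set W₂ := W.filter fun v => t < (D.point v).1 with hW₂
  have hW₁₂ : W₁.card + W₂.card ≤ W.card := by
    have h := Finset.card_filter_add_card_filter_not (s := W) (fun v => (D.point v).1 < t)
    have : W₂.card ≤ (W.filter fun v => ¬ (D.point v).1 < t).card :=
      Finset.card_le_card fun v hv => by
        obtain ⟨h1, h2⟩ := Finset.mem_filter.1 hv
        exact Finset.mem_filter.2 ⟨h1, not_lt.2 h2.le⟩
    omega
  obtain ⟨a, ha, hat⟩ : ∃ a, (∀ v ∈ W, t < (D.point v).1 → a < (D.point v).1) ∧ t < a := by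
    have h1 : ∀ᶠ a in 𝓝[>] t, ∀ v ∈ W, t < (D.point v).1 → a < (D.point v).1 := by
      rw [Filter.eventually_all_finset]
      intro v _
      by_cases hv : t < (D.point v).1
      · filter_upwards [Ioo_mem_nhdsGT hv] with a ha _ using ha.2
      · exact Filter.Eventually.of_forall fun a h => absurd h hv
    exact (h1.and self_mem_nhdsWithin).exists
  obtain ⟨b, hb, hbt⟩ : ∃ b, (∀ v ∈ W, (D.point v).1 < t → (D.point v).1 < b) ∧ b < t := by
    have h1 : ∀ᶠ b in 𝓝[<] t, ∀ v ∈ W, (D.point v).1 < t → (D.point v).1 < b := by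
      rw [Filter.eventually_all_finset]
      intro v _
      by_cases hv : (D.point v).1 < t
      · filter_upwards [Ioo_mem_nhdsLT hv] with a ha _ using ha.1
      · exact Filter.Eventually.of_forall fun a h => absurd h hv
    exact (h1.and self_mem_nhdsWithin).exists
  set S₁ := S.filter fun e => (D.point (F.head e)).1 < t with hS₁
  set S₂ := S.filter fun e => t < (D.point (F.tail e)).1 with hS₂
  set S₃ := S.filter fun e => (D.point (F.tail e)).1 ≤ t ∧ t < (D.point (F.head e)).1 with hS₃
  set S₄ := S.filter fun e => (D.point (F.tail e)).1 < t ∧ t ≤ (D.point (F.head e)).1 with hS₄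
  have hcover : S ⊆ ((S₁ ∪ S₂) ∪ S₃) ∪ S₄ := by
    intro e he
    have hlt := F.tail_lt_head e
    simp only [hS₁, hS₂, hS₃, hS₄, Finset.mem_union, Finset.mem_filter, he, true_and]
    rcases lt_trichotomy (D.point (F.head e)).1 t with h | h | h
    · exact Or.inl (Or.inl (Or.inl h))
    · exact Or.inr ⟨h ▸ hlt, h.ge⟩
    · rcases lt_or_ge t (D.point (F.tail e)).1 with h' | h'
      · exact Or.inl (Or.inl (Or.inr h'))
      · exact Or.inl (Or.inr ⟨h', h⟩)
  have hlog : ∀ m, 2 * m ≤ W.card → Nat.log 2 m ≤ Nat.log 2 W.card - 1 := fun m hm => by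
    rw [← Nat.log_div_base]
    exact Nat.log_mono_right (by omega)
  have c₁ := ih W₁.card (by omega) S₁ W₁ (fun e he => by
    obtain ⟨heS, het⟩ := Finset.mem_filter.1 he
    exact ⟨Finset.mem_filter.2 ⟨(hS e heS).1, (F.tail_lt_head e).trans het⟩,
      Finset.mem_filter.2 ⟨(hS e heS).2, het⟩⟩) rfl
  have c₂ := ih W₂.card (by omega) S₂ W₂ (fun e he => by
    obtain ⟨heS, het⟩ := Finset.mem_filter.1 he
    exact ⟨Finset.mem_filter.2 ⟨(hS e heS).1, het⟩,
      Finset.mem_filter.2 ⟨(hS e heS).2, het.trans (F.tail_lt_head e)⟩⟩) rfl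
  have c₃ := F.card_crossing_line_le hD W S₃ (fun e he => hS e (Finset.mem_filter.1 he).1) a
    (fun e he => by
      obtain ⟨heS, h1, h2⟩ := Finset.mem_filter.1 he
      exact ⟨h1.trans_lt hat, ha _ (hS e heS).2 h2⟩)
  have c₄ := F.card_crossing_line_le hD W S₄ (fun e he => hS e (Finset.mem_filter.1 he).1) b
    (fun e he => by
      obtain ⟨heS, h1, h2⟩ := Finset.mem_filter.1 he
      exact ⟨hb _ (hS e heS).1 h1, hbt.trans_le h2⟩)
  rw [hCW] at c₃ c₄
  have hsum := Finset.card_le_card hcover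
  have u1 := Finset.card_union_le ((S₁ ∪ S₂) ∪ S₃) S₄
  have u2 := Finset.card_union_le (S₁ ∪ S₂) S₃
  have u3 := Finset.card_union_le S₁ S₂
  set l := Nat.log 2 W.card with hl
  have hl1 : 1 ≤ l := Nat.log_pos (by norm_num) hW2
  have d₁ : S₁.card ≤ 8 * C * (W₁.card * (l - 1)) :=
    c₁.trans (Nat.mul_le_mul_left _ (Nat.mul_le_mul_left _ (hlog _ ht1)))
  have d₂ : S₂.card ≤ 8 * C * (W₂.card * (l - 1)) :=
    c₂.trans (Nat.mul_le_mul_left _ (Nat.mul_le_mul_left _ (hlog _ ht2)))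
  have d₃ : C * (2 * W.card + 2) ≤ C * (4 * W.card) := Nat.mul_le_mul_left _ (by omega)
  have d₄ : 8 * C * ((W₁.card + W₂.card) * (l - 1)) ≤ 8 * C * (W.card * (l - 1)) :=
    Nat.mul_le_mul_left _ (Nat.mul_le_mul_right _ hW₁₂)
  calc S.card ≤ 8 * C * (W₁.card * (l - 1)) + 8 * C * (W₂.card * (l - 1)) +
        C * (4 * W.card) + C * (4 * W.card) := by omega
    _ = 8 * C * ((W₁.card + W₂.card) * (l - 1)) + 8 * C * W.card := by ring
    _ ≤ 8 * C * (W.card * (l - 1)) + 8 * C * W.card := by omega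
    _ = 8 * C * (W.card * (l - 1 + 1)) := by ring
    _ = 8 * C * (W.card * l) := by rw [Nat.sub_add_cancel hl1]

end TopologicalGraph.HeightFunctions

/-- The constants of the divide and conquer bound in terms of `k = w + 1`. -/
theorem edge_constant_le (w : ℕ) :
    2 * (8 * (w * (w * (16 * (6 ^ (w ^ 3 + 1)) ^ 2)))) ≤ 2 ^ (15 * (w + 1) ^ 3) := by
  have h1 : w ^ 3 + 1 ≤ (w + 1) ^ 3 := by ring_nf; omega
  have h2 : w * w ≤ 2 ^ (w + 1) ^ 3 := by
    have : w * w ≤ (w + 1) ^ 3 := by nlinarith [Nat.zero_le (w ^ 3), Nat.zero_le (w ^ 2)]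
    exact this.trans Nat.lt_two_pow_self.le
  have h3 : (6 ^ (w ^ 3 + 1)) ^ 2 ≤ 2 ^ (6 * (w + 1) ^ 3) := by
    rw [← pow_mul, mul_comm (w ^ 3 + 1) 2, pow_mul]
    calc (6 ^ 2) ^ (w ^ 3 + 1) ≤ (2 ^ 6) ^ (w ^ 3 + 1) := Nat.pow_le_pow_left (by norm_num) _
      _ ≤ (2 ^ 6) ^ (w + 1) ^ 3 := Nat.pow_le_pow_right (by norm_num) h1
      _ = _ := by rw [← pow_mul]
  have h4 : 256 ≤ 2 ^ (8 * (w + 1) ^ 3) := by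
    have : 2 ^ 8 ≤ 2 ^ (8 * (w + 1) ^ 3) := Nat.pow_le_pow_right (by norm_num) (by
      have : 1 ≤ (w + 1) ^ 3 := Nat.one_le_pow _ _ (by omega)
      omega)
    simpa using this
  calc 2 * (8 * (w * (w * (16 * (6 ^ (w ^ 3 + 1)) ^ 2))))
      = 256 * (w * w) * (6 ^ (w ^ 3 + 1)) ^ 2 := by ring
    _ ≤ 2 ^ (8 * (w + 1) ^ 3) * 2 ^ (w + 1) ^ 3 * 2 ^ (6 * (w + 1) ^ 3) :=
        Nat.mul_le_mul (Nat.mul_le_mul h4 h2) h3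
    _ = 2 ^ (15 * (w + 1) ^ 3) := by rw [← pow_add, ← pow_add]; congr 1; ring

theorem theorem2 :
    ∃ c : ℝ, 0 < c ∧ ∀ (k : ℕ) (V : Type*) [Fintype V] (D : TopologicalGraph V),
      D.IsQuasiPlanar k → D.IsXMonotone →
        (D.graph.edgeSet.ncard : ℝ) ≤
          (2 : ℝ) ^ (c * (k : ℝ) ^ 3) * (Fintype.card V : ℝ) * Real.log (Fintype.card V : ℝ) := by
  classical
  refine ⟨15, by norm_num, ?_⟩
  intro k V _ D hq hx
  obtain ⟨F⟩ := hx.nonempty_heightFunctions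
  -- no drawing is `0`-quasi-planar: the empty set of edges is pairwise crossing
  obtain ⟨w, rfl⟩ : ∃ w, k = w + 1 := by
    rcases k with _ | w
    · exact absurd ⟨∅, rfl, by simp⟩ hq
    · exact ⟨w, rfl⟩
  have : Fintype D.graph.edgeSet := Fintype.ofFinite _
  have hcard := F.card_edges_le hq Finset.univ Finset.univ (fun e _ => by simp)
  rw [Finset.card_univ, Finset.card_univ, ← Nat.card_eq_fintype_card (α := D.graph.edgeSet),
    Nat.card_coe_set_eq] at hcard
  set n := Fintype.card V with hn
  have hpow : (2 : ℝ) ^ (15 * ((w + 1 : ℕ) : ℝ) ^ 3) = ((2 ^ (15 * (w + 1) ^ 3) : ℕ) : ℝ) := by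
    rw [show 15 * ((w + 1 : ℕ) : ℝ) ^ 3 = ((15 * (w + 1) ^ 3 : ℕ) : ℝ) by push_cast; ring,
      Real.rpow_natCast]
    push_cast
    ring
  have hlog : (Nat.log 2 n : ℝ) ≤ 2 * Real.log n := by
    have h1 := Real.natLog_le_logb n 2
    have h2 : (0.5 : ℝ) ≤ Real.log 2 := by linarith [Real.log_two_gt_d9]
    have h3 : 0 ≤ Real.log n := Real.log_natCast_nonneg n
    refine h1.trans ?_
    rw [Real.logb, div_le_iff₀ (by push_cast; linarith)]
    push_cast
    nlinarith
  have hC := edge_constant_le w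
  rw [hpow]
  generalize 8 * (w * (w * (16 * (6 ^ (w ^ 3 + 1)) ^ 2))) = C at hcard hC
  generalize 2 ^ (15 * (w + 1) ^ 3) = K at hC ⊢
  have hC' : (C : ℝ) * 2 ≤ (K : ℝ) := by
    exact_mod_cast (mul_comm C 2).le.trans hC
  calc (D.graph.edgeSet.ncard : ℝ) ≤ (C : ℝ) * ((n : ℝ) * (Nat.log 2 n : ℝ)) := by
        exact_mod_cast hcard
    _ ≤ (C : ℝ) * ((n : ℝ) * (2 * Real.log n)) :=
        mul_le_mul_of_nonneg_left (mul_le_mul_of_nonneg_left hlog n.cast_nonneg) C.cast_nonneg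
    _ = (C : ℝ) * 2 * n * Real.log n := by ring
    _ ≤ _ :=
        mul_le_mul_of_nonneg_right (mul_le_mul_of_nonneg_right hC' n.cast_nonneg)
          (Real.log_natCast_nonneg n)
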